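/- Let $G$ be a $\sigma$-compact locally compact (Hausdorff) abelian group, and let $K\subset G$ be a fixed compact set with nonempty interior. Let $\omega=\sum_{x\in\Gamma}\omega(\{x\})\,\delta_x$ be a nonzero discrete complex Radon measure on $G$ (so $|\omega|(C)<\infty$ for every compact $C\subset G$) which is translation bounded, i.e. $\sup_{t\in G}|\omega|(t+C)<\infty$ for every compact $C$, and let $\Gamma=\{x\in G:\omega(\{x\})\neq 0\}\neq\varnothing$. Write $T_t\omega$ for the translate of $\omega$ by $t$, $\|\omega\|_K=\sup_{t\in G}|\omega|(t+K)$ and $\|\omega\|_\infty=\sup_{x\in G}|\omega(\{x\})|$. A subset $A$ of a group is relatively dense if $A+C$ is the whole group for some compact $C$; it is uniformly discrete if there is a neighbourhood $U$ of $0$ such that $x,y\in A$ and $x-y\in U$ imply $x=y$; it has finite local complexity if $(A-A)\cap C$ is finite for every compact $C$. The measure $\omega$ is norm-almost periodic (resp. sup-almost periodic) if for every $\varepsilon>0$ the set of all $t\in G$ with $\|\omega-T_t\omega\|_K<\varepsilon$ (resp. $\|\omega-T_t\omega\|_\infty<\varepsilon$) is relatively dense; it is strongly almost periodic if for every $f\in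 C_{\mathsf c}(G)$ the function $f*\omega$ is (Bohr) almost periodic, i.e. continuous and such that for every $\varepsilon>0$ the set of all $t$ with $\sup_x|(f*\omega)(x)-(f*\omega)(x-t)|<\varepsilon$ is relatively dense. A cut and project scheme $(G\times H,\mathcal L)$ consists of a locally compact (Hausdorff) abelian group $H$ and a discrete, relatively dense subgroup $\mathcal L$ of $G\times H$ such that the projection $\pi_1:G\times H\to G$ is injective on $\mathcal L$ and $\pi_2(\mathcal L)$ is dense in $H$; for $x\in\pi_1(\mathcal L)$, $x^\star$ is the unique element of $H$ with $(x,x^\star)\in\mathcal L$. Then the following statements are equivalent. (i) $\omega$ is norm-almost periodic and $\Gamma$ has finite local complexity. (ii) $\omega$ is norm-almost periodic and $\Gamma-\Gamma$ is uniformly discrete. (iii) $\omega$ is strongly almost periodic and $\Gamma-\Gamma$ is uniformly discrete. (iv) $\omega$ is sup-almost periodic and $\Gamma-\Gamma$ is uniformly discrete. (v) $\omega$ is sup-almost periodic and $\Gamma$ has finite local complexity. (vi) There exist a cut and project scheme $(G\times H,\mathcal L)$ and a function $f\in C_{\mathsf c}(H)$ such that $\omega=\omega_f:=\sum_{x\in\pi_1(\mathcal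 L)}f(x^\star)\,\delta_x$ (a regular measure). -/

import Mathlib

open scoped Pointwise CompactlySupported Topology

universe u

noncomputable section

/-! ### Point sets in topological groups -/

section PointSets

variable {G : Type*} [AddCommGroup G] [TopologicalSpace G]

/-- `A` is relatively dense: `A + K` is the whole group for some compact `K`. -/
def IsRelativelyDense (A : Set G) : Prop :=
  ∃ K : Set G, IsCompact K ∧ A + K = Set.univ

/-- `A` is locally finite: it meets every compact set in a finite set. -/
def IsLocallyFinite (A : Set G) : Prop :=
  ∀ K : Set G, IsCompact K → (A ∩ K).Finite

/-- `A` has finite local complexity: `A - A` is locally finite. -/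
def HasFiniteLocalComplexity (A : Set G) : Prop :=
  IsLocallyFinite (A - A)

/-- `A` is uniformly discrete: for some neighbourhood `U` of `0`, each `y + U` with `y ∈ A`
contains no point of `A` except `y`. -/
def IsUniformlyDiscrete (A : Set G) : Prop :=
  ∃ U ∈ 𝓝 (0 : G), ∀ x ∈ A, ∀ y ∈ A, x - y ∈ U → x = y

/-- A function is (Bohr) almost periodic: it is continuous and, for every `ε > 0`, its
`ε`-almost periods with respect to the supremum norm are relatively dense. -/
def IsAlmostPeriodicFun (g : G → ℂ) : Prop :=
  Continuous g ∧ ∀ ε : ℝ, 0 < ε →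
    IsRelativelyDense {t : G | (⨆ x, ‖g x - g (x - t)‖ₑ) < ENNReal.ofReal ε}

end PointSets

/-! ### Discrete measures -/

/-- A regular (that is, complex Radon) discrete measure `∑ x, ω({x}) δ_x`, given by its point
masses; regularity says that every compact set has finite total variation. It is in general
neither positive nor finite. -/
@[ext]
structure DiscreteRadonMeasure (G : Type*) [TopologicalSpace G] where
  /-- the point mass `ω({x})` -/
  atom : G → ℂ
  summable_on_compact : ∀ K : Set G, IsCompact K → Summable fun x : K => ‖atom x‖

namespace DiscreteRadonMeasure

variable {G : Type*} [AddCommGroup G] [TopologicalSpace G]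

instance : Sub (DiscreteRadonMeasure G) where
  sub ω ν :=
    { atom := fun x => ω.atom x - ν.atom x
      summable_on_compact := fun K hK =>
        Summable.of_nonneg_of_le (fun _ => norm_nonneg _) (fun _ => norm_sub_le _ _)
          ((ω.summable_on_compact K hK).add (ν.summable_on_compact K hK)) }

/-- The translate `T_t ω`, with `(T_t ω)(A) = ω(A - t)`. -/
def translate [IsTopologicalAddGroup G] (t : G) (ω : DiscreteRadonMeasure G) :
    DiscreteRadonMeasure G where
  atom x := ω.atom (x - t)
  summable_on_compact K hK := by
    have hK' : IsCompact ((fun x => x - t) '' K) := hK.image (by fun_prop)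
    have h := ω.summable_on_compact _ hK'
    exact h.comp_injective
      (i := fun x : K => (⟨x.1 - t, x.1, x.2, rfl⟩ : ((fun x => x - t) '' K : Set G)))
      (fun x y hxy => Subtype.ext (sub_left_injective (Subtype.ext_iff.mp hxy)))

/-- The value `ω(A)`; used for relatively compact sets `A`, where the series converges
absolutely. -/
def mass (ω : DiscreteRadonMeasure G) (A : Set G) : ℂ :=
  ∑' x : A, ω.atom x

/-- The total variation `|ω|(A)`: the supremum of `∑ B ∈ P, |ω(B)|` over all finite families `P`
of pairwise disjoint Borel subsets of `A` (for relatively compact `A`). -/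
def variation (ω : DiscreteRadonMeasure G) (A : Set G) : ENNReal :=
  ⨆ (P : Finset (Set G)) (_ : ∀ B ∈ P, @MeasurableSet G (borel G) B ∧ B ⊆ A)
    (_ : (P : Set (Set G)).PairwiseDisjoint id), ∑ B ∈ P, ‖ω.mass B‖ₑ

/-- The norm `‖ω‖_K = sup_t |ω|(t + K)`. -/
def normOn (K : Set G) (ω : DiscreteRadonMeasure G) : ENNReal :=
  ⨆ t : G, ω.variation (t +ᵥ K)

/-- The norm `‖ω‖_∞ = sup_x |ω({x})|`. -/
def supNorm (ω : DiscreteRadonMeasure G) : ENNReal :=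
  ⨆ x : G, ‖ω.mass {x}‖ₑ

/-- `ω` is translation bounded: `sup_t |ω|(t + K) < ∞` for every compact `K`. -/
def IsTranslationBounded (ω : DiscreteRadonMeasure G) : Prop :=
  ∀ K : Set G, IsCompact K → ω.normOn K < ⊤

/-- The convolution `(f * ω)(x) = ∫ f(x - y) dω(y)`. -/
def conv (f : G → ℂ) (ω : DiscreteRadonMeasure G) (x : G) : ℂ :=
  ∑' y : G, f (x - y) * ω.atom y

variable [IsTopologicalAddGroup G]

/-- Norm-almost periodicity, with respect to the norm `‖·‖_K`. -/
def IsNormAlmostPeriodic (K : Set G) (ω : DiscreteRadonMeasure G) : Prop :=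
  ∀ ε : ℝ, 0 < ε →
    IsRelativelyDense {t : G | (ω - ω.translate t).normOn K < ENNReal.ofReal ε}

/-- Sup-almost periodicity. -/
def IsSupAlmostPeriodic (ω : DiscreteRadonMeasure G) : Prop :=
  ∀ ε : ℝ, 0 < ε →
    IsRelativelyDense {t : G | (ω - ω.translate t).supNorm < ENNReal.ofReal ε}

/-- Strong almost periodicity. -/
def IsStronglyAlmostPeriodic (ω : DiscreteRadonMeasure G) : Prop :=
  ∀ f : C_c(G, ℂ), IsAlmostPeriodicFun (ω.conv f)

end DiscreteRadonMeasure

/-! ### Cut and project schemes -/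

/-- A cut and project scheme `(G × H, 𝓛)`: a lattice `𝓛` (a discrete, relatively dense subgroup) in
`G × H` such that the first projection is injective on `𝓛` and the second one maps `𝓛` onto a dense
subgroup of `H`. (`G` and `H` are to be locally compact Hausdorff abelian groups.) -/
structure CutAndProjectScheme (G H : Type*) [AddCommGroup G] [TopologicalSpace G]
    [AddCommGroup H] [TopologicalSpace H] where
  lattice : AddSubgroup (G × H)
  discrete : DiscreteTopology lattice
  relativelyDense : IsRelativelyDense (lattice : Set (G × H))
  injOn_fst : Set.InjOn Prod.fst (lattice : Set (G × H))
  dense_snd : Dense (Prod.snd '' (lattice : Set (G × H)))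

namespace CutAndProjectScheme

variable {G H : Type*} [AddCommGroup G] [TopologicalSpace G] [AddCommGroup H] [TopologicalSpace H]

/-- The projection `L = π₁(𝓛)`. -/
def proj (S : CutAndProjectScheme G H) : AddSubgroup G :=
  S.lattice.map (AddMonoidHom.fst G H)

theorem exists_mem_lattice (S : CutAndProjectScheme G H) (x : S.proj) :
    ∃ y : H, ((x : G), y) ∈ S.lattice := by
  obtain ⟨x, ⟨⟨a, b⟩, hp, rfl⟩⟩ := x
  exact ⟨b, hp⟩

/-- The star map: `x⋆` is the unique element of `H` with `(x, x⋆) ∈ 𝓛`. -/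
def star (S : CutAndProjectScheme G H) (x : S.proj) : H :=
  (S.exists_mem_lattice x).choose

theorem star_spec (S : CutAndProjectScheme G H) (x : S.proj) : ((x : G), S.star x) ∈ S.lattice :=
  (S.exists_mem_lattice x).choose_spec

open Classical in
/-- The point masses of the formal sum `∑_{x ∈ L} g(x⋆) δ_x`. -/
def combAtom (S : CutAndProjectScheme G H) (g : H → ℂ) (x : G) : ℂ :=
  if hx : x ∈ S.proj then g (S.star ⟨x, hx⟩) else 0

/-- `g` is a window function: the formal sum `∑_{x ∈ L} g(x⋆) δ_x` is a regular measure. -/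
def IsWindowFunction (S : CutAndProjectScheme G H) (g : H → ℂ) : Prop :=
  ∀ K : Set G, IsCompact K → Summable fun x : K => ‖S.combAtom g x‖

/-- The weighted model comb `ω_g = ∑_{x ∈ L} g(x⋆) δ_x`. -/
def comb (S : CutAndProjectScheme G H) (g : H → ℂ) (hg : S.IsWindowFunction g) :
    DiscreteRadonMeasure G where
  atom := S.combAtom g
  summable_on_compact := hg

end CutAndProjectScheme

end

/-! Write `a` for the point masses, Γ for the support of `a`, and P_ε for its sup-norm `ε`-almost
periods. Statement (iv) is the hub. If Γ is uniformly discrete, the number of its points in a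
translate of a compact set is bounded, so smallness in sup norm gives smallness of `‖·‖_K` and of `f
* ω`. The converse for `f * ω` takes `f` to be a narrow bump: on Γ it reads off the atoms
(`IsStronglyAlmostPeriodic.isSupAlmostPeriodic`). The link with finite local complexity is that P_ε
⊆ Γ - Γ once ε < |a(x)| for some x, and Γ ⊆ F + P_ε with F finite. Hence (Γ - Γ) - (Γ - Γ) lies in Γ
- Γ plus a finite set (`isUniformlyDiscrete_support_sub`). For (vi), give the group generated by Γ
the seminorm ‖t‖ = sup |a - T_t a|. Its completion is H, the lattice is the diagonal embedding, and
`f` is the extension of the 1-Lipschitz function `a`. Finite local complexity makes small balls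
totally bounded, so H is locally compact (`totallyBounded_closedBall`,
`DiscreteRadonMeasure.exists_eq_comb_of_seminorm`). Conversely, lattice points with small star
coordinate are almost periods of a comb, by uniform continuity of `f`. -/

theorem IsLocallyFinite.mono {G : Type*} [TopologicalSpace G] {A B : Set G}
    (hB : IsLocallyFinite B) (h : A ⊆ B) : IsLocallyFinite A :=
  fun K hK => (hB K hK).subset (Set.inter_subset_inter_left K h)

/-! ### Discreteness of point sets. -/

section PointSets

variable {G : Type*} [AddCommGroup G] [TopologicalSpace G]

theorem IsRelativelyDense.mono {A B : Set G} (hA : IsRelativelyDense A) (h : A ⊆ B) :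
    IsRelativelyDense B := by
  obtain ⟨C, hC, hAC⟩ := hA
  exact ⟨C, hC, Set.eq_univ_of_univ_subset (hAC ▸ Set.add_subset_add_right h)⟩

theorem IsLocallyFinite.add_finite [IsTopologicalAddGroup G] {A F : Set G}
    (hA : IsLocallyFinite A) (hF : F.Finite) : IsLocallyFinite (A + F) := by
  intro K hK
  have hfin : (A ∩ (K - F)).Finite := hA _ (by
    rw [sub_eq_add_neg]
    exact hK.add hF.neg.isCompact)
  refine (hfin.add hF).subset ?_
  rintro _ ⟨⟨x, hx, c, hc, rfl⟩, hK'⟩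
  exact ⟨x, ⟨hx, x + c, hK', c, hc, by simp⟩, c, hc, rfl⟩

theorem IsLocallyFinite.exists_inter_subset [T2Space G] [LocallyCompactSpace G] {A : Set G}
    (hA : IsLocallyFinite A) : ∃ U ∈ 𝓝 (0 : G), A ∩ U ⊆ {0} := by
  obtain ⟨C, hC, hC0⟩ := exists_compact_mem_nhds (0 : G)
  have hfin : ((A ∩ C) \ {0}).Finite := (hA C hC).subset Set.sdiff_subset
  refine ⟨C ∩ ((A ∩ C) \ {0})ᶜ, Filter.inter_mem hC0
    (hfin.isClosed.isOpen_compl.mem_nhds (by simp)), ?_⟩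
  rintro x ⟨hxA, hxC, hx⟩
  by_contra h0
  exact hx ⟨⟨hxA, hxC⟩, h0⟩

theorem isUniformlyDiscrete_of_isLocallyFinite_sub [T2Space G] [LocallyCompactSpace G] {A : Set G}
    (hA : IsLocallyFinite (A - A)) : IsUniformlyDiscrete A := by
  obtain ⟨U, hU, hAU⟩ := hA.exists_inter_subset
  exact ⟨U, hU, fun x hx y hy hxy => sub_eq_zero.mp (hAU ⟨Set.sub_mem_sub hx hy, hxy⟩)⟩

theorem IsUniformlyDiscrete.of_sub {A : Set G} (hA : IsUniformlyDiscrete (A - A)) :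
    IsUniformlyDiscrete A := by
  obtain ⟨U, hU, hAU⟩ := hA
  refine ⟨U, hU, fun x hx y hy hxy => ?_⟩
  have := hAU (x - x) (Set.sub_mem_sub hx hx) (y - x) (Set.sub_mem_sub hy hx) (by simpa)
  simpa [eq_comm, sub_eq_zero] using this

/-- Cover `C` by finitely many sets `V` with `V - V ⊆ U`; a translate of such a `V` holds at most
one point of `A`. -/
theorem IsUniformlyDiscrete.exists_encard_le [IsTopologicalAddGroup G] {A : Set G}
    (hA : IsUniformlyDiscrete A) {C : Set G} (hC : IsCompact C) :
    ∃ N : ℕ, ∀ t : G, (A ∩ (t +ᵥ C)).encard ≤ N := by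
  obtain ⟨U, hU, hAU⟩ := hA
  refine hC.induction_on (p := fun C => ∃ N : ℕ, ∀ t : G, (A ∩ (t +ᵥ C)).encard ≤ N)
    ⟨0, by simp⟩ ?_ ?_ ?_
  · rintro s t hst ⟨N, hN⟩
    exact ⟨N, fun x => (Set.encard_le_encard
      (Set.inter_subset_inter_right A (Set.vadd_set_mono hst))).trans (hN x)⟩
  · rintro s t ⟨N, hN⟩ ⟨M, hM⟩
    refine ⟨N + M, fun x => ?_⟩
    rw [Set.vadd_set_union, Set.inter_union_distrib_left]
    refine (Set.encard_union_le _ _).trans ?_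
    push_cast
    exact add_le_add (hN x) (hM x)
  · intro x _
    have hV : {p : G × G | p.1 - p.2 ∈ U} ∈ 𝓝 (x, x) :=
      (continuous_sub.tendsto (x, x)) (by simpa using hU)
    rw [nhds_prod_eq, Filter.mem_prod_same_iff] at hV
    obtain ⟨V, hV, hVU⟩ := hV
    refine ⟨V, mem_nhdsWithin_of_mem_nhds hV, 1, fun t => ?_⟩
    rw [Nat.cast_one, Set.encard_le_one_iff]
    rintro _ _ ⟨ha, a, haV, rfl⟩ ⟨hb, b, hbV, rfl⟩
    refine hAU _ ha _ hb ?_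
    have : (a, b) ∈ V ×ˢ V := ⟨haV, hbV⟩
    simpa using hVU this

theorem IsUniformlyDiscrete.isLocallyFinite [IsTopologicalAddGroup G] {A : Set G}
    (hA : IsUniformlyDiscrete A) : IsLocallyFinite A := by
  intro K hK
  obtain ⟨N, hN⟩ := hA.exists_encard_le hK
  simpa using Set.finite_of_encard_le_coe (hN 0)

end PointSets

/-! ### Sup-norm almost periods and differences of the support. -/

section AlmostPeriods

variable {G : Type*} [AddCommGroup G]

/-- The `ε`-almost periods of `a` with respect to the supremum norm. -/
def almostPeriods (a : G → ℂ) (ε : ℝ) : Set G :=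
  {t | ∀ x, ‖a x - a (x - t)‖ ≤ ε}

variable {a : G → ℂ} {ε δ : ℝ}

theorem neg_mem_almostPeriods {t : G} (ht : t ∈ almostPeriods a ε) :
    -t ∈ almostPeriods a ε := by
  intro x
  have := ht (x + t)
  rwa [norm_sub_rev, add_sub_cancel_right, ← sub_neg_eq_add] at this

theorem add_mem_almostPeriods {s t : G} (hs : s ∈ almostPeriods a ε)
    (ht : t ∈ almostPeriods a δ) : s + t ∈ almostPeriods a (ε + δ) := by
  intro x
  have h1 := hs x
  have h2 := ht (x - s)
  rw [sub_sub] at h2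
  exact (norm_sub_le_norm_sub_add_norm_sub _ _ _).trans (add_le_add h1 h2)

theorem sub_mem_almostPeriods {s t : G} (hs : s ∈ almostPeriods a ε)
    (ht : t ∈ almostPeriods a δ) : s - t ∈ almostPeriods a (ε + δ) :=
  sub_eq_add_neg s t ▸ add_mem_almostPeriods hs (neg_mem_almostPeriods ht)

theorem sub_mem_support_of_mem_almostPeriods {x t : G} (hx : ε < ‖a x‖)
    (ht : t ∈ almostPeriods a ε) : x - t ∈ Function.support a := by
  intro h
  have := ht x
  rw [h, sub_zero] at this
  exact this.not_gt hx

theorem almostPeriods_subset_support_sub {x : G} (hx : ε < ‖a x‖) (hε : 0 ≤ ε) :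
    almostPeriods a ε ⊆ Function.support a - Function.support a := by
  intro t ht
  refine ⟨x, fun h => ?_, x - t, sub_mem_support_of_mem_almostPeriods hx ht, by simp⟩
  rw [h, norm_zero] at hx
  exact hε.not_gt hx

variable [TopologicalSpace G]

/-- For `y` in the support write `x - y = p + c` with `p` an almost period and `c ∈ C`. Then `c = (x
- p) - y` is a difference of support points, so only finitely many `c` occur, and `y = (x - c) +
(-p)`. -/
theorem exists_finite_support_subset {x : G} (hx : ε < ‖a x‖)
    (hd : IsRelativelyDense (almostPeriods a ε))
    (hS : HasFiniteLocalComplexity (Function.support a)) :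
    ∃ F : Set G, F.Finite ∧ Function.support a ⊆ F + almostPeriods a ε := by
  obtain ⟨C, hC, hPC⟩ := hd
  refine ⟨{x} - (Function.support a - Function.support a) ∩ C,
    (Set.finite_singleton x).sub (hS C hC), fun y hy => ?_⟩
  obtain ⟨p, hp, c, hc, hpc⟩ : x - y ∈ almostPeriods a ε + C := hPC ▸ Set.mem_univ _
  have hc' : c = x - p - y := by
    simp only at hpc
    rw [sub_right_comm, ← hpc]
    abel
  refine ⟨x - c, ⟨x, rfl, c, ⟨?_, hc⟩, rfl⟩, -p, neg_mem_almostPeriods hp, ?_⟩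
  · exact hc' ▸ Set.sub_mem_sub (sub_mem_support_of_mem_almostPeriods hx hp) hy
  · simp only [hc']
    abel

theorem isUniformlyDiscrete_support_sub [IsTopologicalAddGroup G] [T2Space G]
    [LocallyCompactSpace G] (h0 : (Function.support a).Nonempty)
    (hd : ∀ ε > 0, IsRelativelyDense (almostPeriods a ε))
    (hS : HasFiniteLocalComplexity (Function.support a)) :
    IsUniformlyDiscrete (Function.support a - Function.support a) := by
  obtain ⟨x, hx⟩ := h0
  have hx0 : 0 < ‖a x‖ := norm_pos_iff.mpr hx
  -- Four almost periods are combined below; their errors add up to `4‖a x‖/5`, still less than `‖a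
  -- x‖`.
  obtain ⟨F, hF, hSF⟩ := exists_finite_support_subset (x := x) (ε := ‖a x‖ / 5) (by linarith)
    (hd _ (by linarith)) hS
  apply isUniformlyDiscrete_of_isLocallyFinite_sub
  refine (IsLocallyFinite.add_finite hS ((hF.sub hF).sub (hF.sub hF))).mono ?_
  rintro _ ⟨_, ⟨s₁, h₁, s₂, h₂, rfl⟩, _, ⟨s₃, h₃, s₄, h₄, rfl⟩, rfl⟩
  obtain ⟨f₁, hf₁, p₁, hp₁, rfl⟩ := hSF h₁
  obtain ⟨f₂, hf₂, p₂, hp₂, rfl⟩ := hSF h₂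
  obtain ⟨f₃, hf₃, p₃, hp₃, rfl⟩ := hSF h₃
  obtain ⟨f₄, hf₄, p₄, hp₄, rfl⟩ := hSF h₄
  refine ⟨p₁ - p₂ - (p₃ - p₄), ?_, f₁ - f₂ - (f₃ - f₄),
    Set.sub_mem_sub (Set.sub_mem_sub hf₁ hf₂) (Set.sub_mem_sub hf₃ hf₄), by dsimp only; abel⟩
  refine almostPeriods_subset_support_sub (x := x) ?_ ?_
    (sub_mem_almostPeriods (sub_mem_almostPeriods hp₁ hp₂) (sub_mem_almostPeriods hp₃ hp₄))
  · linarith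
  · positivity

/-- The points of `x + C` where `a` or its translate by `t` does not vanish lie in a finite set
whose size depends only on `C`. -/
theorem exists_card_le_of_isUniformlyDiscrete [IsTopologicalAddGroup G]
    (hS : IsUniformlyDiscrete (Function.support a)) {C : Set G} (hC : IsCompact C) :
    ∃ N : ℕ, ∀ x t : G, ∃ T : Finset G, T.card ≤ N ∧
      ∀ y ∈ x +ᵥ C, y ∉ T → a y = 0 ∧ a (y - t) = 0 := by
  classical
  obtain ⟨N, hN⟩ := hS.exists_encard_le hC
  refine ⟨N + N, fun x t => ?_⟩
  obtain ⟨h₁, hc₁⟩ := Set.encard_le_coe_iff_finite_ncard_le.mp (hN x)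
  obtain ⟨h₂, hc₂⟩ := Set.encard_le_coe_iff_finite_ncard_le.mp (hN (x - t))
  refine ⟨h₁.toFinset ∪ h₂.toFinset.image (· + t), ?_, fun y hy hyT => ?_⟩
  · refine (Finset.card_union_le _ _).trans (add_le_add ?_ (Finset.card_image_le.trans ?_))
    · rwa [← Set.ncard_eq_toFinset_card _ h₁]
    · rwa [← Set.ncard_eq_toFinset_card _ h₂]
  · rw [Finset.mem_union, not_or] at hyT
    refine ⟨by_contra fun h => hyT.1 (by simpa using ⟨h, hy⟩), by_contra fun h => hyT.2 ?_⟩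
    refine Finset.mem_image.mpr ⟨y - t, ?_, by simp⟩
    rw [Set.Finite.mem_toFinset]
    obtain ⟨c, hc, rfl⟩ := hy
    exact ⟨h, c, hc, by simp only [vadd_eq_add]; abel⟩

end AlmostPeriods

theorem norm_lt_of_iSup_enorm_lt {ι : Type*} {u : ι → ℂ} {ε : ℝ}
    (h : (⨆ x, ‖u x‖ₑ) < ENNReal.ofReal ε) (x : ι) : ‖u x‖ < ε := by
  have := (le_iSup (fun x => ‖u x‖ₑ) x).trans_lt h
  rw [← ofReal_norm] at this
  exact ENNReal.ofReal_lt_ofReal_iff'.mp this |>.1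

theorem iSup_enorm_lt_of_norm_le {ι : Type*} {u : ι → ℂ} {δ ε : ℝ} (hε : 0 < ε) (hδ : δ < ε)
    (h : ∀ x, ‖u x‖ ≤ δ) : (⨆ x, ‖u x‖ₑ) < ENNReal.ofReal ε := by
  refine (iSup_le fun x => ?_).trans_lt ((ENNReal.ofReal_lt_ofReal_iff hε).mpr hδ)
  rw [← ofReal_norm]
  exact ENNReal.ofReal_le_ofReal (h x)

/-! ### Comparison of the norms on measures. -/

namespace DiscreteRadonMeasure

variable {G : Type*} [TopologicalSpace G]

theorem mass_singleton (ω : DiscreteRadonMeasure G) (x : G) : ω.mass {x} = ω.atom x := by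
  simp [mass]

theorem enorm_atom_le_variation [T1Space G] (ω : DiscreteRadonMeasure G) {A : Set G} {x : G}
    (hx : x ∈ A) : ‖ω.atom x‖ₑ ≤ ω.variation A := by
  refine le_trans ?_ (le_iSup₂_of_le {{x}} ?_ (le_iSup_of_le ?_ le_rfl))
  · simp [mass_singleton]
  · intro B hB
    rw [Finset.mem_singleton] at hB
    subst hB
    borelize G
    exact ⟨(isClosed_singleton (x := x)).measurableSet, by simpa⟩
  · simp

theorem variation_le_card_mul (ω : DiscreteRadonMeasure G) {A : Set G} {T : Finset G} {ε : ENNReal}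
    (hT : ∀ x ∈ A, x ∉ T → ω.atom x = 0) (hε : ∀ x, ‖ω.atom x‖ₑ ≤ ε) :
    ω.variation A ≤ T.card * ε := by
  classical
  refine iSup₂_le fun P hP => iSup_le fun hPd => ?_
  have hmass : ∀ B ∈ P, ‖ω.mass B‖ₑ ≤ ∑ x ∈ T, if x ∈ B then ε else 0 := by
    intro B hB
    have : ω.mass B = ∑ x ∈ T, B.indicator ω.atom x := by
      rw [mass, tsum_subtype]
      refine tsum_eq_sum fun x hx => ?_
      by_cases hxB : x ∈ B
      · rw [Set.indicator_of_mem hxB, hT x ((hP B hB).2 hxB) hx]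
      · exact Set.indicator_of_notMem hxB _
    rw [this]
    refine (enorm_sum_le _ _).trans (Finset.sum_le_sum fun x _ => ?_)
    by_cases hxB : x ∈ B
    · simpa [hxB] using hε x
    · simp [hxB]
  refine (Finset.sum_le_sum hmass).trans ?_
  -- After exchanging the sums, disjointness of `P` lets each point of `T` contribute at most once.
  rw [Finset.sum_comm, ← nsmul_eq_mul]
  refine Finset.sum_le_card_nsmul _ _ _ fun x _ => ?_
  by_cases h : ∃ B ∈ P, x ∈ B
  · obtain ⟨B, hB, hxB⟩ := h
    rw [Finset.sum_eq_single_of_mem B hB]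
    · simp [hxB]
    · intro B' hB' hne
      rw [if_neg]
      exact fun hxB' => Set.disjoint_left.mp (hPd hB' hB hne) hxB' hxB
  · rw [Finset.sum_eq_zero]
    · exact zero_le
    · exact fun B hB => if_neg fun hx => h ⟨B, hB, hx⟩

variable [AddCommGroup G]

theorem conv_sub (ω : DiscreteRadonMeasure G) (f : G → ℂ) (x t : G) :
    ω.conv f (x - t) = ∑' y, f (x - y) * ω.atom (y - t) := by
  rw [conv, ← (Equiv.subRight t).tsum_eq]
  simp

theorem enorm_atom_le_normOn [IsTopologicalAddGroup G] [T2Space G] (ω : DiscreteRadonMeasure G)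
    {K : Set G} (hK : K.Nonempty) (x : G) : ‖ω.atom x‖ₑ ≤ ω.normOn K := by
  obtain ⟨k, hk⟩ := hK
  refine le_iSup_of_le (x - k) (ω.enorm_atom_le_variation ⟨k, hk, ?_⟩)
  simp

variable [IsTopologicalAddGroup G] {ω : DiscreteRadonMeasure G}

theorem sub_translate_atom (t x : G) :
    (ω - ω.translate t).atom x = ω.atom x - ω.atom (x - t) := rfl

theorem supNorm_sub_translate (t : G) :
    (ω - ω.translate t).supNorm = ⨆ x, ‖ω.atom x - ω.atom (x - t)‖ₑ := by
  simp only [supNorm, mass_singleton, sub_translate_atom]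

theorem isSupAlmostPeriodic_iff :
    ω.IsSupAlmostPeriodic ↔ ∀ ε > 0, IsRelativelyDense (almostPeriods ω.atom ε) := by
  simp only [IsSupAlmostPeriodic, supNorm_sub_translate]
  constructor
  · exact fun h ε hε => (h ε hε).mono fun t ht x => (norm_lt_of_iSup_enorm_lt ht x).le
  -- Halving turns the pointwise `≤` into a strict bound on the supremum.
  · exact fun h ε hε => (h (ε / 2) (half_pos hε)).mono fun t ht =>
      iSup_enorm_lt_of_norm_le hε (half_lt_self hε) ht

theorem IsNormAlmostPeriodic.isSupAlmostPeriodic [T2Space G] {K : Set G} (hK : K.Nonempty)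
    (h : ω.IsNormAlmostPeriodic K) : ω.IsSupAlmostPeriodic := by
  refine fun ε hε => (h ε hε).mono fun t ht =>
    Set.mem_ofPred.mpr (lt_of_le_of_lt (iSup_le fun x => ?_) ht)
  rw [mass_singleton]
  exact enorm_atom_le_normOn _ hK x

theorem IsSupAlmostPeriodic.isNormAlmostPeriodic {K : Set G} (hK : IsCompact K)
    (h : ω.IsSupAlmostPeriodic) (hS : IsUniformlyDiscrete (Function.support ω.atom)) :
    ω.IsNormAlmostPeriodic K := by
  intro ε hε
  obtain ⟨N, hN⟩ := exists_card_le_of_isUniformlyDiscrete hS hK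
  rw [isSupAlmostPeriodic_iff] at h
  have hpos : 0 < ε / (N + 1) := by positivity
  refine (h _ hpos).mono fun t ht => ?_
  have hle : (ω - ω.translate t).normOn K ≤ N * ENNReal.ofReal (ε / (N + 1)) := by
    refine iSup_le fun x => ?_
    obtain ⟨T, hTN, hT⟩ := hN x t
    refine (variation_le_card_mul (ε := ENNReal.ofReal (ε / (N + 1))) _ (T := T)
      (fun y hy hyT => ?_) fun y => ?_).trans (by gcongr)
    · rw [sub_translate_atom, (hT y hy hyT).1, (hT y hy hyT).2, sub_zero]
    · rw [sub_translate_atom, ← ofReal_norm]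
      exact ENNReal.ofReal_le_ofReal (ht y)
  refine hle.trans_lt ?_
  rw [← ENNReal.ofReal_natCast, ← ENNReal.ofReal_mul (Nat.cast_nonneg N),
    ENNReal.ofReal_lt_ofReal_iff hε, mul_div_assoc', div_lt_iff₀ (by positivity)]
  linarith

theorem IsTranslationBounded.exists_norm_atom_le [T2Space G] (hω : ω.IsTranslationBounded) :
    ∃ M : ℝ, ∀ x, ‖ω.atom x‖ ≤ M := by
  refine ⟨(ω.normOn {0}).toReal, fun x => ?_⟩
  rw [← toReal_enorm]
  exact ENNReal.toReal_mono (hω _ isCompact_singleton).ne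
    (ω.enorm_atom_le_normOn (Set.singleton_nonempty 0) x)

theorem continuous_conv [LocallyCompactSpace G] (hS : IsLocallyFinite (Function.support ω.atom))
    (f : C_c(G, ℂ)) : Continuous (ω.conv f) := by
  rw [continuous_iff_continuousAt]
  intro x
  obtain ⟨C, hC, hCx⟩ := exists_compact_mem_nhds x
  have hD : IsCompact (C - tsupport f) := by
    rw [sub_eq_add_neg]
    exact hC.add f.hasCompactSupport.isCompact.neg
  have hfin := hS _ hD
  have heq : ∀ z ∈ C, ω.conv f z = ∑ y ∈ hfin.toFinset, f (z - y) * ω.atom y := by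
    refine fun z hz => tsum_eq_sum fun y hy => by_contra fun hne => hy ?_
    rw [Set.Finite.mem_toFinset]
    exact ⟨right_ne_zero_of_mul hne, z, hz, z - y,
      subset_tsupport _ (left_ne_zero_of_mul hne), by simp⟩
  refine ContinuousAt.congr (f := fun z => ∑ y ∈ hfin.toFinset, f (z - y) * ω.atom y) ?_
    (Filter.mem_of_superset hCx fun z hz => (heq z hz).symm)
  have := f.continuous
  fun_prop

theorem IsSupAlmostPeriodic.isStronglyAlmostPeriodic [LocallyCompactSpace G]
    (h : ω.IsSupAlmostPeriodic) (hS : IsUniformlyDiscrete (Function.support ω.atom)) :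
    ω.IsStronglyAlmostPeriodic := by
  refine fun f => ⟨continuous_conv hS.isLocallyFinite f, fun ε hε => ?_⟩
  rw [isSupAlmostPeriodic_iff] at h
  obtain ⟨N, hN⟩ := exists_card_le_of_isUniformlyDiscrete hS f.hasCompactSupport.isCompact.neg
  obtain ⟨M, hM⟩ := f.hasCompactSupport.exists_bound_of_continuous f.continuous
  have hM0 : 0 ≤ M := (norm_nonneg _).trans (hM 0)
  have hpos : 0 < ε / (N * M + 1) := by positivity
  refine (h _ hpos).mono fun t ht => iSup_enorm_lt_of_norm_le
    (δ := N * (M * (ε / (N * M + 1)))) hε ?_ fun x => ?_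
  · rw [← mul_assoc, mul_div_assoc', div_lt_iff₀ (by positivity)]
    linarith
  · obtain ⟨T, hTN, hT⟩ := hN x t
    have hf : ∀ y ∉ T, f (x - y) ≠ 0 → ω.atom y = 0 ∧ ω.atom (y - t) = 0 := by
      refine fun y hy hne => hT y ⟨y - x, ?_, by simp⟩ hy
      rw [Set.mem_neg, neg_sub]
      exact subset_tsupport _ hne
    have h1 : ω.conv f x = ∑ y ∈ T, f (x - y) * ω.atom y :=
      tsum_eq_sum fun y hy => mul_eq_zero.mpr (or_iff_not_imp_left.mpr fun h => (hf y hy h).1)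
    have h2 : ω.conv f (x - t) = ∑ y ∈ T, f (x - y) * ω.atom (y - t) := by
      rw [conv_sub]
      exact tsum_eq_sum fun y hy =>
        mul_eq_zero.mpr (or_iff_not_imp_left.mpr fun h => (hf y hy h).2)
    rw [h1, h2, ← Finset.sum_sub_distrib]
    calc _ ≤ ∑ y ∈ T, M * (ε / (N * M + 1)) := by
          refine norm_sum_le_of_le _ fun y _ => ?_
          rw [← mul_sub, norm_mul]
          exact mul_le_mul (hM _) (ht y) (norm_nonneg _) hM0
      _ ≤ N * (M * (ε / (N * M + 1))) := by
          rw [Finset.sum_const, nsmul_eq_mul]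
          gcongr

end DiscreteRadonMeasure

/-! ### From strong to sup-almost periodicity. -/

section Bump

variable {G : Type*} [AddCommGroup G] [TopologicalSpace G]

theorem IsRelativelyDense.of_subset_add [IsTopologicalAddGroup G] {A B D : Set G}
    (hA : IsRelativelyDense A) (hD : IsCompact D) (h : A ⊆ B + D) : IsRelativelyDense B := by
  obtain ⟨C, hC, hAC⟩ := hA
  refine ⟨D + C, hD.add hC, Set.eq_univ_of_univ_subset ?_⟩
  rw [← hAC, ← add_assoc]
  exact Set.add_subset_add_right h

/-- The product `g x * g (-x)` makes an Urysohn function even. Evenness later yields the same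
coefficient `g v` from shifts by `v` and by `-v`. -/
theorem exists_symmetric_bump [IsTopologicalAddGroup G] [T2Space G] [LocallyCompactSpace G]
    {V : Set G} (hV : V ∈ 𝓝 0) :
    ∃ (f : C_c(G, ℂ)) (g : G → ℝ), (∀ x, f x = g x) ∧ g 0 = 1 ∧ (∀ x, 0 ≤ g x) ∧
      (∀ x, g (-x) = g x) ∧ ∀ x, g x ≠ 0 → x ∈ V := by
  obtain ⟨g, hg1, hg0, hgc, hg⟩ := exists_continuous_one_zero_of_isCompact
    (isCompact_singleton (x := (0 : G))) isOpen_interior.isClosed_compl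
    (s := {0}) (t := (interior V)ᶜ)
    (Set.disjoint_left.mpr fun x hx hxV => hxV (by
      rw [Set.mem_singleton_iff.mp hx]
      exact mem_interior_iff_mem_nhds.mpr hV))
  have h0 : g 0 = 1 := hg1 rfl
  have hc : HasCompactSupport fun x => ((g x * g (-x) : ℝ) : ℂ) :=
    hgc.mono fun x hx h => hx (by simp [h])
  refine ⟨⟨⟨fun x => ((g x * g (-x) : ℝ) : ℂ), by fun_prop⟩, hc⟩, fun x => g x * g (-x),
    fun x => rfl, by simp [h0], fun x => mul_nonneg (hg x).1 (hg (-x)).1, fun x => ?_,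
    fun x hx => ?_⟩
  · simp only [neg_neg, mul_comm]
  · by_contra h
    exact left_ne_zero_of_mul hx (hg0 fun h' => h (interior_subset h'))

end Bump

namespace DiscreteRadonMeasure

variable {G : Type*} [AddCommGroup G] [TopologicalSpace G] {ω : DiscreteRadonMeasure G}

theorem conv_eq_single {f : G → ℂ} {x : G} (y : G)
    (h : ∀ z, ω.atom z ≠ 0 → f (x - z) ≠ 0 → z = y) :
    ω.conv f x = f (x - y) * ω.atom y := by
  refine tsum_eq_single y fun z hz => by_contra fun hne => hz ?_
  exact h z (right_ne_zero_of_mul hne) (left_ne_zero_of_mul hne)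

/-- Adding the two estimates bounds `(1 + c)(a - b)`, and `1 + c ≥ 1`. If one of `a`, `b` vanishes,
the other estimate suffices alone. -/
theorem norm_sub_le_two_mul {a b : ℂ} {c ε : ℝ} (hc : 0 ≤ c) (hε : 0 ≤ ε)
    (ha : a ≠ 0 → ‖a - c * b‖ ≤ ε) (hb : b ≠ 0 → ‖c * a - b‖ ≤ ε) : ‖a - b‖ ≤ 2 * ε := by
  by_cases ha0 : a = 0
  · by_cases hb0 : b = 0
    · simpa [ha0, hb0]
    · have := hb hb0
      simp only [ha0, mul_zero] at this ⊢
      linarith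
  by_cases hb0 : b = 0
  · have := ha ha0
    simp only [hb0, mul_zero] at this ⊢
    linarith
  have h : ((1 + c : ℝ) : ℂ) * (a - b) = (a - c * b) + (c * a - b) := by
    push_cast
    ring
  have h1 : (1 + c) * ‖a - b‖ ≤ ε + ε := by
    calc (1 + c) * ‖a - b‖ = ‖((1 + c : ℝ) : ℂ) * (a - b)‖ := by
          rw [norm_mul, Complex.norm_real, Real.norm_of_nonneg (by linarith)]
      _ ≤ ε + ε := by
          rw [h]
          exact norm_add_le_of_le (ha ha0) (hb hb0)
  nlinarith [mul_nonneg hc (norm_nonneg (a - b))]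

/-- An almost period `t` of `f * ω` need not be a difference of support points, but it misses one
only by a small `v`. Uniform discreteness of the difference set makes `v` independent of the base
point, and `t - v` is an almost period of the atoms. -/
theorem IsStronglyAlmostPeriodic.isSupAlmostPeriodic [IsTopologicalAddGroup G] [T2Space G]
    [LocallyCompactSpace G] (h : ω.IsStronglyAlmostPeriodic)
    (h0 : (Function.support ω.atom).Nonempty)
    (hS : IsUniformlyDiscrete (Function.support ω.atom - Function.support ω.atom)) :
    ω.IsSupAlmostPeriodic := by
  obtain ⟨x₀, hx₀⟩ := h0
  obtain ⟨U, hU, hSU⟩ := hS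
  obtain ⟨D, hD, hD0⟩ := exists_compact_mem_nhds (0 : G)
  have hW : {p : G × G | p.1 - p.2 ∈ U} ∈ 𝓝 ((0 : G), (0 : G)) :=
    (continuous_sub.tendsto (0, 0)) (by simpa using hU)
  rw [nhds_prod_eq, Filter.mem_prod_same_iff] at hW
  obtain ⟨W, hW, hWU⟩ := hW
  obtain ⟨f, g, hfg, hg1, hg0, hgs, hgV⟩ := exists_symmetric_bump (Filter.inter_mem hW hD0)
  have hfne : ∀ x, f x ≠ 0 → g x ≠ 0 := fun x hx hgx => hx (by simp [hfg, hgx])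
  have hsub : ∀ v w, g v ≠ 0 → g w ≠ 0 → v - w ∈ U := by
    intro v w hv hw
    have : (v, w) ∈ W ×ˢ W := ⟨(hgV v hv).1, (hgV w hw).1⟩
    exact hWU this
  have hconv : ∀ x, ω.atom x ≠ 0 → ω.conv f x = ω.atom x := by
    intro x hx
    rw [conv_eq_single x, hfg, sub_self, hg1, Complex.ofReal_one, one_mul]
    intro z hz hfz
    have := hSU (x - x) (Set.sub_mem_sub hx hx) (z - x) (Set.sub_mem_sub hz hx)
      (by simpa using hsub (x - z) 0 (hfne _ hfz) (by simp [hg1]))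
    simpa [eq_comm, sub_eq_zero] using this
  rw [isSupAlmostPeriodic_iff]
  intro ε hε
  have hδ : 0 < min (ε / 2) ‖ω.atom x₀‖ := lt_min (half_pos hε) (norm_pos_iff.mpr hx₀)
  set δ := min (ε / 2) ‖ω.atom x₀‖
  refine ((h f).2 δ hδ).of_subset_add hD fun t ht => ?_
  replace ht := norm_lt_of_iSup_enorm_lt ht
  -- Since `δ ≤ ‖ω.atom x₀‖`, the convolution cannot vanish at `x₀ - t`.
  obtain ⟨y, hy, hfy⟩ : ∃ y, ω.atom y ≠ 0 ∧ f (x₀ - t - y) ≠ 0 := by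
    by_contra! hcon
    have hz : ω.conv f (x₀ - t) = 0 := by
      refine (tsum_congr fun y => ?_).trans tsum_zero
      by_cases hy : ω.atom y = 0
      · rw [hy, mul_zero]
      · rw [hcon y hy, zero_mul]
    have := ht x₀
    rw [hz, sub_zero, hconv _ hx₀] at this
    exact (this.trans_le (min_le_right _ _)).false
  obtain ⟨v, rfl⟩ : ∃ v, y = x₀ - t + v := ⟨y - (x₀ - t), by abel⟩
  have hv : g v ≠ 0 := by
    have := hfne _ hfy
    rwa [sub_add_cancel_left, hgs] at this
  have huniq : ∀ w, g w ≠ 0 →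
      t - w ∈ Function.support ω.atom - Function.support ω.atom → w = v := by
    intro w hw htw
    have := hSU (t - v) ⟨x₀, hx₀, _, hy, by simp only; abel⟩ (t - w) htw
      (by simpa using hsub w v hw hv)
    simpa using this.symm
  refine ⟨t - v, fun x => ?_, v, (hgV v hv).2, by simp⟩
  have hle : 2 * δ ≤ ε := by
    have := min_le_left (ε / 2) ‖ω.atom x₀‖
    linarith
  refine (norm_sub_le_two_mul (hg0 v) hδ.le (fun hx => ?_) fun hx => ?_).trans hle
  · have := ht x
    rw [hconv x hx, conv_eq_single (x - (t - v)), hfg] at this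
    · rw [show x - t - (x - (t - v)) = -v by abel, hgs] at this
      exact this.le
    · intro z hz hfz
      have hw := huniq (z - (x - t)) (by rw [← hgs, neg_sub]; exact hfne _ hfz)
        ⟨x, hx, z, hz, by simp only; abel⟩
      rw [← hw]
      abel
  · have := ht (x + v)
    rw [show x + v - t = x - (t - v) by abel, hconv _ hx, conv_eq_single x, hfg,
      add_sub_cancel_left] at this
    · exact this.le
    · intro z hz hfz
      have hw := huniq (x + v - z) (hfne _ hfz) ⟨z, hz, _, hx, by simp only; abel⟩
      rw [← sub_eq_zero, ← neg_eq_zero, neg_sub, ← sub_eq_zero.mpr hw]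
      abel

end DiscreteRadonMeasure

/-! ### Combs of cut and project schemes. -/

namespace CutAndProjectScheme

variable {G H : Type*} [AddCommGroup G] [TopologicalSpace G] [AddCommGroup H] [TopologicalSpace H]
  (S : CutAndProjectScheme G H)

theorem combAtom_eq {g : H → ℂ} {x : G} {y : H} (h : (x, y) ∈ S.lattice) :
    S.combAtom g x = g y := by
  have hx : x ∈ S.proj := ⟨(x, y), h, rfl⟩
  have := congrArg Prod.snd (S.injOn_fst (S.star_spec ⟨x, hx⟩) h rfl)
  rw [combAtom, dif_pos hx]
  exact congrArg g this

theorem combAtom_eq_zero {g : H → ℂ} {x : G} (h : ∀ y, (x, y) ∉ S.lattice) :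
    S.combAtom g x = 0 := by
  rw [combAtom, dif_neg]
  rintro ⟨⟨_, y⟩, hy, rfl⟩
  exact h y hy

theorem exists_of_combAtom_ne_zero {g : H → ℂ} {x : G} (h : S.combAtom g x ≠ 0) :
    ∃ y, (x, y) ∈ S.lattice ∧ g y ≠ 0 := by
  by_contra! hcon
  by_cases hx : ∃ y, (x, y) ∈ S.lattice
  · obtain ⟨y, hy⟩ := hx
    exact h (by rw [S.combAtom_eq hy, hcon y hy])
  · exact h (S.combAtom_eq_zero (not_exists.mp hx))

variable [IsTopologicalAddGroup G] [IsTopologicalAddGroup H]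

/-- Relative density of the lattice controls the `H`-coordinate only up to a compact set. By density
of the second projection, finitely many lattice points suffice to move it into `U`, and their first
coordinates only enlarge the compact set in `G`. -/
theorem isRelativelyDense_of_mem_nhds {U : Set H} (hU : U ∈ 𝓝 0) :
    IsRelativelyDense {x : G | ∃ y ∈ U, (x, y) ∈ S.lattice} := by
  obtain ⟨C, hC, hSC⟩ := S.relativelyDense
  have hcover : ∃ F : Set G, F.Finite ∧ ∀ c ∈ Prod.snd '' C, ∃ l ∈ F, ∃ y,
      (l, y) ∈ S.lattice ∧ y - c ∈ U := by
    refine (hC.image continuous_snd).induction_on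
      (p := fun D => ∃ F : Set G, F.Finite ∧ ∀ c ∈ D, ∃ l ∈ F, ∃ y,
        (l, y) ∈ S.lattice ∧ y - c ∈ U) ⟨∅, by simp⟩ ?_ ?_ ?_
    · rintro s t hst ⟨F, hF, h⟩
      exact ⟨F, hF, fun c hc => h c (hst hc)⟩
    · rintro s t ⟨F, hF, h⟩ ⟨F', hF', h'⟩
      refine ⟨F ∪ F', hF.union hF', ?_⟩
      rintro c (hc | hc)
      · obtain ⟨l, hl, hy⟩ := h c hc
        exact ⟨l, Or.inl hl, hy⟩
      · obtain ⟨l, hl, hy⟩ := h' c hc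
        exact ⟨l, Or.inr hl, hy⟩
    · intro c _
      have hcont : Continuous fun p : H × H => p.2 - p.1 := by fun_prop
      have hV : {p : H × H | p.2 - p.1 ∈ U} ∈ 𝓝 (c, c) :=
        (hcont.tendsto (c, c)) (by simpa using hU)
      rw [nhds_prod_eq, Filter.mem_prod_iff] at hV
      obtain ⟨V, hV, W, hW, hVW⟩ := hV
      obtain ⟨_, ⟨⟨l, y⟩, hl, rfl⟩, hyW⟩ := S.dense_snd.inter_nhds_nonempty hW
      refine ⟨V, mem_nhdsWithin_of_mem_nhds hV, {l}, Set.finite_singleton l, fun c' hc' => ?_⟩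
      have : (c', y) ∈ V ×ˢ W := ⟨hc', hyW⟩
      exact ⟨l, rfl, y, hl, hVW this⟩
  obtain ⟨F, hF, hcov⟩ := hcover
  refine ⟨Prod.fst '' C - F, ?_, Set.eq_univ_of_univ_subset fun x _ => ?_⟩
  · rw [sub_eq_add_neg]
    exact (hC.image continuous_fst).add hF.neg.isCompact
  obtain ⟨⟨m, n⟩, hm, ⟨c, d⟩, hcd, hx⟩ : (x, (0 : H)) ∈ (S.lattice : Set (G × H)) + C :=
    hSC ▸ Set.mem_univ _
  obtain ⟨hx1, hx2⟩ := Prod.ext_iff.mp hx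
  simp only [Prod.mk_add_mk] at hx1 hx2
  obtain ⟨l, hl, y, hly, hy⟩ := hcov d ⟨_, hcd, rfl⟩
  refine ⟨m + l, ⟨n + y, ?_, S.lattice.add_mem hm hly⟩, c - l, ⟨c, ⟨_, hcd, rfl⟩, l, hl, rfl⟩, ?_⟩
  · rwa [eq_neg_of_add_eq_zero_left hx2, neg_add_eq_sub]
  · simp only [← hx1]
    abel

theorem isRelativelyDense_almostPeriods_combAtom (f : C_c(H, ℂ)) {ε : ℝ} (hε : 0 < ε) :
    IsRelativelyDense (almostPeriods (S.combAtom f) ε) := by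
  let _ := IsTopologicalAddGroup.rightUniformSpace H
  have := isUniformAddGroup_of_addCommGroup (G := H)
  have huc := f.hasCompactSupport.uniformContinuous_of_continuous f.continuous
  have hU : ∀ᶠ u in 𝓝 (0 : H), ∀ y, ‖f y - f (y - u)‖ ≤ ε := by
    have h2 : ∀ᶠ p in uniformity H, ‖f p.1 - f p.2‖ ≤ ε := by
      filter_upwards [huc (Metric.dist_mem_uniformity hε)] with p hp
      rw [← dist_eq_norm]
      exact (Set.mem_ofPred.mp hp).le
    rw [uniformity_eq_comap_nhds_zero H] at h2
    obtain ⟨V, hV, hVf⟩ := h2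
    filter_upwards [hV] with u hu y
    rw [norm_sub_rev]
    exact hVf (a := (y - u, y)) (by simpa using hu)
  refine (S.isRelativelyDense_of_mem_nhds hU).mono ?_
  rintro t ⟨u, hu, htu⟩ x
  -- Translation by `t` preserves `π₁(𝓛)`, so outside it both values are zero.
  by_cases hx : ∃ y, (x, y) ∈ S.lattice
  · obtain ⟨y, hy⟩ := hx
    rw [S.combAtom_eq hy, S.combAtom_eq (S.lattice.sub_mem hy htu)]
    exact hu y
  · rw [S.combAtom_eq_zero (not_exists.mp hx), S.combAtom_eq_zero, sub_zero, norm_zero]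
    · exact hε.le
    · intro y hy
      exact hx ⟨y + u, by simpa using S.lattice.add_mem hy htu⟩

variable [T2Space G] [T2Space H]

/-- The model set with a compact window is locally finite. -/
theorem isLocallyFinite_of_isCompact {D : Set H} (hD : IsCompact D) :
    IsLocallyFinite {x : G | ∃ y ∈ D, (x, y) ∈ S.lattice} := by
  intro C hC
  have := S.discrete
  have hcl : IsClosed (S.lattice : Set (G × H)) := AddSubgroup.isClosed_of_discrete
  have hfin : ((S.lattice : Set (G × H)) ∩ C ×ˢ D).Finite :=
    ((hC.prod hD).inter_left hcl).finite
      (IsDiscrete.mono ⟨S.discrete⟩ Set.inter_subset_left)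
  refine (hfin.image Prod.fst).subset ?_
  rintro x ⟨⟨y, hy, hxy⟩, hx⟩
  exact ⟨(x, y), ⟨hxy, hx, hy⟩, rfl⟩

theorem isUniformlyDiscrete_support_combAtom_sub [LocallyCompactSpace G] (f : C_c(H, ℂ)) :
    IsUniformlyDiscrete
      (Function.support (S.combAtom f) - Function.support (S.combAtom f)) := by
  have hD := f.hasCompactSupport.isCompact
  have hD' : IsCompact (tsupport f - tsupport f - (tsupport f - tsupport f)) := by
    simp only [sub_eq_add_neg]
    exact (hD.add hD.neg).add (hD.add hD.neg).neg
  apply isUniformlyDiscrete_of_isLocallyFinite_sub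
  refine (S.isLocallyFinite_of_isCompact hD').mono ?_
  rintro _ ⟨_, ⟨x₁, h₁, x₂, h₂, rfl⟩, _, ⟨x₃, h₃, x₄, h₄, rfl⟩, rfl⟩
  obtain ⟨y₁, hy₁, hf₁⟩ := S.exists_of_combAtom_ne_zero h₁
  obtain ⟨y₂, hy₂, hf₂⟩ := S.exists_of_combAtom_ne_zero h₂
  obtain ⟨y₃, hy₃, hf₃⟩ := S.exists_of_combAtom_ne_zero h₃
  obtain ⟨y₄, hy₄, hf₄⟩ := S.exists_of_combAtom_ne_zero h₄
  have hs := subset_tsupport f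
  exact ⟨y₁ - y₂ - (y₃ - y₄), Set.sub_mem_sub (Set.sub_mem_sub (hs hf₁) (hs hf₂))
    (Set.sub_mem_sub (hs hf₃) (hs hf₄)),
    S.lattice.sub_mem (S.lattice.sub_mem hy₁ hy₂) (S.lattice.sub_mem hy₃ hy₄)⟩

end CutAndProjectScheme

/-! ### Construction of the internal space and of the scheme. -/

section InternalSpace

open UniformSpace Metric

variable {G M : Type*} [AddCommGroup G] [SeminormedAddCommGroup M] {a : G → ℂ} {j : M →+ G}
  {r ρ : ℝ}

theorem denseRange_ball_subset_closure (M : Type*) [SeminormedAddCommGroup M] (r : ℝ) :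
    ball (0 : Completion M) r ⊆ closure ((↑) '' closedBall (0 : M) r) := by
  refine (Completion.denseRange_coe.open_subset_closure_inter isOpen_ball).trans
    (closure_mono ?_)
  rintro _ ⟨hx, m, rfl⟩
  refine ⟨m, ?_, rfl⟩
  rw [mem_ball_zero_iff, Completion.norm_coe] at hx
  simpa using hx.le

theorem map_mem_almostPeriods (h1 : ∀ m x, ‖a x - a (x - j m)‖ ≤ ‖m‖) {m : M} (hm : ‖m‖ ≤ r) :
    j m ∈ almostPeriods a r :=
  fun x => (h1 m x).trans hm

variable [TopologicalSpace G]

/-- Almost periods of small norm form a totally bounded set. -/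
theorem totallyBounded_closedBall (hj : Function.Injective j)
    (h1 : ∀ m x, ‖a x - a (x - j m)‖ ≤ ‖m‖)
    (h2 : ∀ r, 0 ≤ r → r < ρ → ∀ t ∈ almostPeriods a r, ∃ m, j m = t ∧ ‖m‖ ≤ r)
    (hρ : almostPeriods a ρ ⊆ Function.support a - Function.support a)
    (hd : ∀ ε > 0, IsRelativelyDense (almostPeriods a ε))
    (hS : HasFiniteLocalComplexity (Function.support a)) (hr : 0 ≤ r) (hrρ : r < ρ) :
    TotallyBounded (closedBall (0 : M) r) := by
  rw [Metric.totallyBounded_iff]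
  intro ε hε
  have hδ : 0 < min (ε / 2) (ρ - r) := lt_min (half_pos hε) (sub_pos.mpr hrρ)
  set δ := min (ε / 2) (ρ - r)
  have hδε : δ < ε := (min_le_left _ _).trans_lt (half_lt_self hε)
  have hδρ : r + δ ≤ ρ := by linarith [min_le_right (ε / 2) (ρ - r)]
  -- The bound `ρ / 2` keeps the error strictly below `ρ`, as `h2` demands, even when `r = 0`.
  have hpos : 0 < min δ (ρ / 2) := lt_min hδ (by linarith)
  obtain ⟨C, hC, hPC⟩ := hd _ hpos
  refine ⟨j ⁻¹' ((Function.support a - Function.support a) ∩ C),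
    (hS C hC).preimage hj.injOn, fun m hm => ?_⟩
  rw [mem_closedBall_zero_iff] at hm
  obtain ⟨q, hq, c, hc, hqc⟩ : j m ∈ almostPeriods a (min δ (ρ / 2)) + C :=
    hPC ▸ Set.mem_univ _
  obtain ⟨m', rfl, hm'⟩ := h2 _ hpos.le ((min_le_right _ _).trans_lt (by linarith)) q hq
  replace hm' := hm'.trans (min_le_left _ _)
  have hc' : c = j (m - m') := by
    rw [map_sub, ← hqc]
    simp
  -- `m - m'` has norm at most `ρ`, so its image lies in the difference set as well as in `C`:
  -- finitely many centres suffice.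
  refine Set.mem_biUnion (x := m - m') ⟨hρ ?_, hc' ▸ hc⟩ ?_
  · exact map_mem_almostPeriods h1
      ((norm_sub_le _ _).trans ((add_le_add hm hm').trans hδρ))
  · rw [mem_ball, dist_eq_norm, sub_sub_cancel]
    exact hm'.trans_lt hδε

end InternalSpace

section Construction

open UniformSpace Metric

variable {G M : Type u} [AddCommGroup G] [TopologicalSpace G] [IsTopologicalAddGroup G]
  [T2Space G] [LocallyCompactSpace G] [SeminormedAddCommGroup M] {j : M →+ G}
  {ρ : ℝ}

/-- `M` stands for the group generated by the support. The map `ι` into the completion may have a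
kernel (exact periods); only `j` has to be injective. -/
theorem DiscreteRadonMeasure.exists_eq_comb_of_seminorm (ω : DiscreteRadonMeasure G)
    (hj : Function.Injective j)
    (h1 : ∀ m x, ‖ω.atom x - ω.atom (x - j m)‖ ≤ ‖m‖)
    (h2 : ∀ r, 0 ≤ r → r < ρ → ∀ t ∈ almostPeriods ω.atom r, ∃ m, j m = t ∧ ‖m‖ ≤ r)
    (h3 : ∀ x, ω.atom x ≠ 0 → ∃ m, j m = x)
    {x₀ : G} (hρ0 : 0 < ρ) (hρ : ρ < ‖ω.atom x₀‖)
    (hd : ∀ ε > 0, IsRelativelyDense (almostPeriods ω.atom ε))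
    (hS : HasFiniteLocalComplexity (Function.support ω.atom)) :
    ∃ (H : Type u) (_ : AddCommGroup H) (_ : TopologicalSpace H) (_ : IsTopologicalAddGroup H)
      (_ : T2Space H) (_ : LocallyCompactSpace H) (S : CutAndProjectScheme G H)
      (f : C_c(H, ℂ)) (hf : S.IsWindowFunction f), ω = S.comb f hf := by
  have hPS := almostPeriods_subset_support_sub hρ hρ0.le
  obtain ⟨r, hr0, hrρ⟩ := exists_between hρ0
  have htb := totallyBounded_closedBall hj h1 h2 hPS hd hS hr0.le hrρ
  set B : Set (Completion M) := closure ((↑) '' closedBall (0 : M) r)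
  have hB : IsCompact B :=
    (htb.image (Completion.uniformContinuous_coe M)).closure.isCompact_of_isClosed isClosed_closure
  have hballB : ball (0 : Completion M) r ⊆ B := denseRange_ball_subset_closure M r
  have hlc : LocallyCompactSpace (Completion M) :=
    hB.locallyCompactSpace_of_mem_nhds_of_addGroup
      (Filter.mem_of_superset (ball_mem_nhds 0 hr0) hballB)
  let ι : M →+ Completion M :=
    { toFun := (↑), map_zero' := Completion.coe_zero, map_add' := Completion.coe_add }
  have hι : ∀ m, ι m = (m : Completion M) := fun _ => rfl
  let S : CutAndProjectScheme G (Completion M) :=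
    { lattice := (j.prod ι).range
      discrete := by
        obtain ⟨U, hU, hSU⟩ := IsLocallyFinite.exists_inter_subset hS
        refine discreteTopology_of_isOpen_singleton_zero ?_
        have hopen : U ×ˢ ball (0 : Completion M) r ∈ 𝓝 (0 : G × Completion M) :=
          prod_mem_nhds hU (ball_mem_nhds 0 hr0)
        rw [isOpen_singleton_iff_nhds_eq_pure]
        refine le_antisymm (Filter.le_pure_iff.mpr ?_) (pure_le_nhds _)
        refine mem_nhds_subtype _ _ _ |>.mpr ⟨_, hopen, ?_⟩
        rintro ⟨_, m, rfl⟩ ⟨hmU, hmr⟩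
        have hmr' : ‖m‖ < r := by
          rw [← Completion.norm_coe]
          exact mem_ball_zero_iff.mp hmr
        -- A small norm puts `j m` in the difference set, where `0` is isolated.
        have hjm : j m = 0 :=
          hSU ⟨hPS (map_mem_almostPeriods h1 (hmr'.trans hrρ).le), hmU⟩
        have hm0 : m = 0 := hj (hjm.trans (map_zero j).symm)
        subst hm0
        exact Subtype.ext (map_zero (j.prod ι))
      relativelyDense := by
        obtain ⟨C, hC, hPC⟩ := hd (r / 2) (half_pos hr0)
        refine ⟨C ×ˢ B, hC.prod hB, Set.eq_univ_of_univ_subset ?_⟩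
        rintro ⟨g, h⟩ -
        obtain ⟨m, hm⟩ := Completion.denseRange_coe.exists_dist_lt h (half_pos hr0)
        obtain ⟨p, hp, c, hc, hpc⟩ : g - j m ∈ almostPeriods ω.atom (r / 2) + C :=
          hPC ▸ Set.mem_univ _
        obtain ⟨m', rfl, hm'⟩ := h2 _ (half_pos hr0).le (by linarith) p hp
        refine ⟨(j (m + m'), ι (m + m')), ⟨m + m', rfl⟩, (c, h - ι (m + m')),
          ⟨hc, hballB ?_⟩, ?_⟩
        · rw [mem_ball_zero_iff, map_add, ← sub_sub]
          refine (norm_sub_le _ _).trans_lt ?_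
          rw [dist_eq_norm] at hm
          have : ‖ι m'‖ ≤ r / 2 := by rwa [hι, Completion.norm_coe]
          have : ‖h - ι m‖ < r / 2 := hm
          linarith
        · ext
          · simp only [Prod.mk_add_mk, map_add]
            rw [add_assoc, show j m' + c = g - j m from hpc]
            simp
          · simp
      injOn_fst := by
        rintro _ ⟨m, rfl⟩ _ ⟨m', rfl⟩ h
        rw [hj h]
      dense_snd := by
        refine Completion.denseRange_coe.mono ?_
        rintro _ ⟨m, rfl⟩
        exact ⟨_, ⟨m, rfl⟩, rfl⟩ }
  have huc : UniformContinuous (ω.atom ∘ j) := by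
    rw [Metric.uniformContinuous_iff]
    refine fun ε hε => ⟨ε, hε, fun m m' h => ?_⟩
    have := h1 (m - m') (j m)
    rw [← map_sub, sub_sub_cancel] at this
    rw [dist_eq_norm] at h ⊢
    exact this.trans_lt h
  have hext : ∀ m : M, Completion.extension (ω.atom ∘ j) m = ω.atom (j m) :=
    Completion.extension_coe huc
  obtain ⟨F, hF, hFS⟩ := exists_finite_support_subset (hrρ.trans hρ) (hd r hr0) hS
  have hF' : (j ⁻¹' F).Finite := hF.preimage hj.injOn
  have hK : IsCompact (ι '' (j ⁻¹' F) + B) := (hF'.image ι).isCompact.add hB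
  have hsupp : Function.support (Completion.extension (ω.atom ∘ j)) ⊆ ι '' (j ⁻¹' F) + B := by
    -- The support of the extension is open, so its points coming from `M` are dense in it; these
    -- lie in a finite set plus a small ball.
    refine (Completion.denseRange_coe.open_subset_closure_inter
      Completion.continuous_extension.isOpen_support).trans
      (closure_minimal ?_ hK.isClosed)
    rintro _ ⟨hm, m, rfl⟩
    rw [Function.mem_support, hext] at hm
    obtain ⟨φ, hφ, p, hp, hφp⟩ := hFS hm
    obtain ⟨m', rfl, hm'⟩ := h2 r hr0.le hrρ p hp
    have hφ' : j (m - m') = φ := by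
      rw [map_sub, ← hφp]
      simp
    refine ⟨ι (m - m'), ⟨_, by rwa [Set.mem_preimage, hφ'], rfl⟩, ι m',
      subset_closure ⟨m', by simpa using hm', rfl⟩, ?_⟩
    exact (map_add ι _ _).symm.trans (congrArg ι (sub_add_cancel m m'))
  let f : C_c(Completion M, ℂ) :=
    ⟨⟨Completion.extension (ω.atom ∘ j), Completion.continuous_extension⟩,
      HasCompactSupport.of_support_subset_isCompact hK hsupp⟩
  have hatom : ω.atom = S.combAtom f := by
    ext x
    by_cases hx : ∃ m, j m = x
    · obtain ⟨m, rfl⟩ := hx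
      rw [S.combAtom_eq (y := ι m) ⟨m, rfl⟩]
      exact (hext m).symm
    · rw [S.combAtom_eq_zero, not_not.mp (mt (h3 x) hx)]
      rintro y ⟨m, hm⟩
      exact hx ⟨m, congrArg Prod.fst hm⟩
  have hf : S.IsWindowFunction f := by
    have := ω.summable_on_compact
    rwa [hatom] at this
  exact ⟨Completion M, inferInstance, inferInstance, inferInstance, inferInstance, hlc, S, f, hf,
    DiscreteRadonMeasure.ext hatom⟩

theorem bddAbove_range_norm_sub {G : Type*} [AddCommGroup G] {a : G → ℂ}
    (ha : ∃ C : ℝ, ∀ x, ‖a x‖ ≤ C) (t : G) :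
    BddAbove (Set.range fun x => ‖a x - a (x - t)‖) := by
  obtain ⟨C, hC⟩ := ha
  refine ⟨C + C, ?_⟩
  rintro _ ⟨x, rfl⟩
  exact norm_sub_le_of_le (hC _) (hC _)

/-- The seminorm `t ↦ sup_x |a x - a (x - t)|` of a bounded function. -/
noncomputable def translationSeminorm {G : Type*} [AddCommGroup G] (L : AddSubgroup G) (a : G → ℂ)
    (ha : ∃ C : ℝ, ∀ x, ‖a x‖ ≤ C) : AddGroupSeminorm L where
  toFun t := ⨆ x, ‖a x - a (x - t)‖
  map_zero' := by simp
  add_le' s t := by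
    refine ciSup_le fun x => ?_
    have h1 := le_ciSup (bddAbove_range_norm_sub ha (s : G)) x
    have h2 := le_ciSup (bddAbove_range_norm_sub ha (t : G)) (x - s)
    simp only [sub_sub] at h2
    exact (norm_sub_le_norm_sub_add_norm_sub _ _ _).trans (add_le_add h1 h2)
  neg' t := by
    refine (Equiv.addRight (t : G)).iSup_congr fun x => ?_
    simp [norm_sub_rev (a x)]

theorem DiscreteRadonMeasure.IsSupAlmostPeriodic.exists_eq_comb {ω : DiscreteRadonMeasure G}
    (h : ω.IsSupAlmostPeriodic) (hω : ω.IsTranslationBounded)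
    (h0 : (Function.support ω.atom).Nonempty)
    (hS : HasFiniteLocalComplexity (Function.support ω.atom)) :
    ∃ (H : Type u) (_ : AddCommGroup H) (_ : TopologicalSpace H) (_ : IsTopologicalAddGroup H)
      (_ : T2Space H) (_ : LocallyCompactSpace H) (S : CutAndProjectScheme G H)
      (f : C_c(H, ℂ)) (hf : S.IsWindowFunction f), ω = S.comb f hf := by
  obtain ⟨x₀, hx₀⟩ := h0
  have hpos : 0 < ‖ω.atom x₀‖ := norm_pos_iff.mpr hx₀
  have ha := hω.exists_norm_atom_le
  let L := AddSubgroup.closure (Function.support ω.atom)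
  let inst : SeminormedAddCommGroup L :=
    (translationSeminorm L ω.atom ha).toSeminormedAddCommGroup
  have hnorm : ∀ t : L, ‖t‖ = ⨆ x, ‖ω.atom x - ω.atom (x - t)‖ := fun _ => rfl
  -- Almost periods with error below `‖ω.atom x₀‖` are differences of support points, hence lie in
  -- `L`.
  refine ω.exists_eq_comb_of_seminorm (j := L.subtype) (ρ := ‖ω.atom x₀‖ / 2) L.subtype_injective
    (fun t x => ?_) (fun r hr hrρ t ht => ?_) (fun x hx => ?_) (half_pos hpos)
    (half_lt_self hpos) (isSupAlmostPeriodic_iff.mp h) hS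
  · rw [hnorm]
    exact le_ciSup (bddAbove_range_norm_sub ha (t : G)) x
  · obtain ⟨x, hx, y, hy, rfl⟩ :=
      almostPeriods_subset_support_sub (hrρ.trans (half_lt_self hpos)) hr ht
    refine ⟨⟨x - y, L.sub_mem (AddSubgroup.subset_closure hx)
      (AddSubgroup.subset_closure hy)⟩, rfl, ?_⟩
    rw [hnorm]
    exact ciSup_le ht
  · exact ⟨⟨x, AddSubgroup.subset_closure hx⟩, rfl⟩

end Construction

theorem mainTheorem3 {G : Type u} [AddCommGroup G] [TopologicalSpace G] [IsTopologicalAddGroup G]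
    [T2Space G] [LocallyCompactSpace G] [SigmaCompactSpace G]
    (K : Set G) (hK : IsCompact K) (hK' : (interior K).Nonempty)
    (ω : DiscreteRadonMeasure G) (hω : ω.IsTranslationBounded)
    (Γ : Set G) (hΓ : Γ.Nonempty) (hne : ∀ x ∈ Γ, ω.mass {x} ≠ 0)
    (hzero : ∀ x ∉ Γ, ω.mass {x} = 0) :
    List.TFAE [
      ω.IsNormAlmostPeriodic K ∧ HasFiniteLocalComplexity Γ,
      ω.IsNormAlmostPeriodic K ∧ IsUniformlyDiscrete (Γ - Γ),
      ω.IsStronglyAlmostPeriodic ∧ IsUniformlyDiscrete (Γ - Γ),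
      ω.IsSupAlmostPeriodic ∧ IsUniformlyDiscrete (Γ - Γ),
      ω.IsSupAlmostPeriodic ∧ HasFiniteLocalComplexity Γ,
      ∃ (H : Type u) (_ : AddCommGroup H) (_ : TopologicalSpace H) (_ : IsTopologicalAddGroup H)
        (_ : T2Space H) (_ : LocallyCompactSpace H) (S : CutAndProjectScheme G H)
        (f : C_c(H, ℂ)) (hf : S.IsWindowFunction f), ω = S.comb f hf] := by
  obtain rfl : Γ = Function.support ω.atom := by
    ext x
    rw [Function.mem_support, ← ω.mass_singleton]
    exact ⟨hne x, fun h => by_contra fun hx => h (hzero x hx)⟩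
  have hKne : K.Nonempty := hK'.mono interior_subset
  have hUD : ω.IsSupAlmostPeriodic → HasFiniteLocalComplexity (Function.support ω.atom) →
      IsUniformlyDiscrete (Function.support ω.atom - Function.support ω.atom) :=
    fun h => isUniformlyDiscrete_support_sub hΓ (ω.isSupAlmostPeriodic_iff.mp h)
  tfae_have 1 → 2 := fun ⟨h, hS⟩ => ⟨h, hUD (h.isSupAlmostPeriodic hKne) hS⟩
  tfae_have 2 → 4 := fun ⟨h, hS⟩ => ⟨h.isSupAlmostPeriodic hKne, hS⟩
  tfae_have 3 → 4 := fun ⟨h, hS⟩ => ⟨h.isSupAlmostPeriodic hΓ hS, hS⟩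
  tfae_have 4 → 3 := fun ⟨h, hS⟩ => ⟨h.isStronglyAlmostPeriodic hS.of_sub, hS⟩
  tfae_have 4 → 1 := fun ⟨h, hS⟩ => ⟨h.isNormAlmostPeriodic hK hS.of_sub, hS.isLocallyFinite⟩
  tfae_have 4 → 5 := fun ⟨h, hS⟩ => ⟨h, hS.isLocallyFinite⟩
  tfae_have 5 → 6 := fun ⟨h, hS⟩ => h.exists_eq_comb hω hΓ hS
  tfae_have 6 → 4 := by
    rintro ⟨H, _, _, _, _, _, S, f, hf, rfl⟩
    exact ⟨DiscreteRadonMeasure.isSupAlmostPeriodic_iff.mpr fun ε hε =>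
      S.isRelativelyDense_almostPeriods_combAtom f hε,
      S.isUniformlyDiscrete_support_combAtom_sub f⟩
  tfae_finish
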